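/- For a capacity $C$, item sizes $s_1,\dots,s_n\in[1,C]$, item values $v_1,\dots,v_n\in[0,1]$ and a parameter $\rho\ge 0$, the greedy algorithm with parameter $\rho$ processes the items in decreasing order of the score $v_i/s_i^{\rho}$ (ties in any order) and adds each item whose size does not exceed the remaining capacity; let $S_\rho$ be the set of selected items. There is an absolute constant $A$ with the following property. Let $n\in\mathbb N$, $\kappa\ge 0$, $C\ge 1$ and $R\ge 0$. For $t=1,2,\dots$ let $s^{(t)}_1,\dots,s^{(t)}_n\in[1,C]$ be fixed sizes, and let $v^{(t)}_i$ ($t\ge 1$, $1\le i\le n$) be mutually independent random values in $[0,1]$, each $\kappa$-smooth, i.e. having a (possibly different) density bounded by $\kappa$. Let $\ell_t:[0,R]\to\mathbb R$, $\ell_t(\rho)=C-\sum_{i\in S^{(t)}_\rho}v^{(t)}_i$, be the loss of the greedy algorithm with parameter $\rho$ on the $t$-th instance (with capacity $C$). Then: 1. Each $\ell_t$ is piecewise constant: $[0,R]$ is a disjoint union of finitely many intervals (possibly single points) on each of which $\ell_t$ is constant. 2. The losses are $f$-dispersed for the Lipschitz constant $0$ with $$f(T,\epsilon)=T\epsilon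 n^2\kappa^2\ln C+A\sqrt{T\ln(Tn)}$$ (where $\sqrt{T\ln(Tn)}:=0$ if $Tn=0$). That is, for all $T\in\mathbb N$ and $\epsilon>0$, $$\mathbb E\Bigl[\max_{\rho\in[0,R]}\#\{1\le t\le T:\ \ell_t\text{ is not constant on }[\rho-\epsilon,\rho+\epsilon]\cap[0,R]\}\Bigr]\le f(T,\epsilon).$$ 3. The losses are $\tfrac12$-dispersed for the Lipschitz constant $0$: there are constants $B$ and $k$ depending only on $n,\kappa,C$ such that for all $T\ge 1$ and all $\epsilon\ge T^{-1/2}$ the expectation in 2 is at most $B\,\epsilon T\,(1+\ln T)^k$ (i.e. it is $\tilde O(\epsilon T)$). The expectation is understood as an upper expectation (infimum of the expectations of measurable upper bounds), which is the usual expectation whenever the maximum is measurable; with a tie-breaking rule that is not measurable the maximum need not be. -/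

import Mathlib

open MeasureTheory ProbabilityTheory
open scoped NNReal ENNReal

noncomputable section

namespace Knapsack

/-! ### Expectation -/

/-- Upper expectation of a nonnegative quantity `X`: the infimum of the expectations of the
measurable functions that dominate `X`.  For measurable `X` it is the expectation `∫⁻ ω, X ω ∂μ`
(see `upperExpectation_eq`); it also makes sense for a supremum over uncountably many
parameters, without a measurability assumption. -/
def upperExpectation {Ω : Type*} [MeasurableSpace Ω] (μ : Measure Ω) (X : Ω → ℝ≥0∞) : ℝ≥0∞ :=
  ⨅ (g : Ω → ℝ≥0∞) (_ : Measurable g) (_ : ∀ ω, X ω ≤ g ω), ∫⁻ ω, g ω ∂μ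

theorem upperExpectation_eq {Ω : Type*} [MeasurableSpace Ω] (μ : Measure Ω) (X : Ω → ℝ≥0∞)
    (hX : Measurable X) : upperExpectation μ X = ∫⁻ ω, X ω ∂μ := by
  apply le_antisymm
  · exact iInf_le_of_le X (iInf_le_of_le hX (iInf_le_of_le (fun _ => le_rfl) le_rfl))
  · exact le_iInf fun g => le_iInf fun _ => le_iInf fun h => lintegral_mono h

/-! ### Dispersion of a random sequence of loss functions -/

section Dispersion

variable {Ω E : Type*} [MeasurableSpace Ω] [PseudoMetricSpace E]

/-- The number of functions among the first `T` functions of the sequence `ℓ` (defined on the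
parameter space `K`) that are not `L`-Lipschitz on the closed ball `B(ρ, ε)`. -/
def nonLipschitzCount (K : Set E) (L : ℝ≥0) (ℓ : ℕ → E → ℝ) (T : ℕ) (ε : ℝ) (ρ : E) : ℕ :=
  Set.ncard {t : ℕ | t < T ∧ ¬ LipschitzOnWith L (ℓ t) (Metric.closedBall ρ ε ∩ K)}

/-- `E[max_{ρ ∈ K} #{t ≤ T : ℓ_t is not L-Lipschitz on B(ρ, ε)}]`. -/
def expectedWorstCount (μ : Measure Ω) (K : Set E) (L : ℝ≥0) (ℓ : ℕ → Ω → E → ℝ)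
    (T : ℕ) (ε : ℝ) : ℝ≥0∞ :=
  upperExpectation μ fun ω =>
    ⨆ ρ ∈ K, (nonLipschitzCount K L (fun t => ℓ t ω) T ε ρ : ℝ≥0∞)

/-- `f`-dispersion for the Lipschitz constant `L`.  The comparison is made in `EReal`, since `f`
is real-valued. -/
def FDispersed (μ : Measure Ω) (K : Set E) (L : ℝ≥0) (ℓ : ℕ → Ω → E → ℝ)
    (f : ℕ → ℝ → ℝ) : Prop :=
  ∀ (T : ℕ) (ε : ℝ), 0 < ε → (expectedWorstCount μ K L ℓ T ε : EReal) ≤ (f T ε : EReal)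

/-- `β`-dispersion for the Lipschitz constant `L`, where the soft-O bound is witnessed by the
constant `B` and the power `k` of the logarithm: for all `T ≥ 1` and `ε ≥ T ^ (-β)` the expected
worst count is at most `B * (ε T) * (1 + log T) ^ k`. -/
def BetaDispersedWith (μ : Measure Ω) (K : Set E) (L : ℝ≥0) (ℓ : ℕ → Ω → E → ℝ)
    (β : ℝ) (B : ℝ) (k : ℕ) : Prop :=
  ∀ (T : ℕ) (ε : ℝ), 1 ≤ T → (T : ℝ) ^ (-β) ≤ ε →
    (expectedWorstCount μ K L ℓ T ε : EReal) ≤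
      ((B * (ε * T) * (1 + Real.log T) ^ k : ℝ) : EReal)

end Dispersion

/-- `f` is piecewise constant on `K ⊆ ℝ`: `K` is partitioned into finitely many intervals
(possibly single points) on each of which `f` is constant. -/
def PiecewiseConstantOn (f : ℝ → ℝ) (K : Set ℝ) : Prop :=
  ∃ P : Finset (Set ℝ),
    (∀ I ∈ P, I.OrdConnected) ∧ (P : Set (Set ℝ)).PairwiseDisjoint id ∧ (⋃ I ∈ P, I) = K ∧
      ∀ I ∈ P, ∃ c : ℝ, ∀ ρ ∈ I, f ρ = c

/-! ### Smoothness -/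

/-- A real random variable is `κ`-smooth if it has a density (with respect to Lebesgue measure)
bounded by `κ`. -/
def IsSmooth {Ω : Type*} [MeasurableSpace Ω] (μ : Measure Ω) (κ : ℝ≥0) (X : Ω → ℝ) : Prop :=
  HasPDF X μ volume ∧ pdf X μ volume ≤ᵐ[volume] fun _ => (κ : ℝ≥0∞)

/-! ### The greedy knapsack algorithms -/

section Greedy

variable {n : ℕ}

/-- The score `σ_ρ(i) = v_i / s_i ^ ρ`. -/
def score (v s : Fin n → ℝ) (ρ : ℝ) (i : Fin n) : ℝ := v i / s i ^ ρ

/-- `π` lists the items in decreasing order of score (ties in any order). -/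
def IsScoreOrder (v s : Fin n → ℝ) (ρ : ℝ) (π : Equiv.Perm (Fin n)) : Prop :=
  Antitone fun k => score v s ρ (π k)

/-- One step of the greedy algorithm.  The state consists of the set of selected items and the
remaining capacity; item `i` is added if it still fits. -/
def greedyStep (s : Fin n → ℝ) (st : Finset (Fin n) × ℝ) (i : Fin n) : Finset (Fin n) × ℝ :=
  if s i ≤ st.2 then (insert i st.1, st.2 - s i) else st

/-- The set of items selected when the items are processed in the order `π 0, π 1, …`. -/
def greedySet (s : Fin n → ℝ) (C : ℝ) (π : Equiv.Perm (Fin n)) : Finset (Fin n) :=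
  ((List.finRange n).foldl (fun st k => greedyStep s st (π k)) (∅, C)).1

/-- The loss: capacity minus the total value of the items selected with the order `π`. -/
def greedyLoss (v s : Fin n → ℝ) (C : ℝ) (π : Equiv.Perm (Fin n)) : ℝ :=
  C - ∑ i ∈ greedySet s C π, v i

end Greedy

end Knapsack

end

/-! Two items of different sizes and positive values have equal scores at exactly one real
parameter, (log v_i − log v_j)/(log s_i − log s_j). On an interval free of these critical points, at
most n²/2 per instance, the score order is fixed and the remaining ties are harmless, so the loss is
constant (`greedyLoss_eq_of_crossing_notMem`). This gives piecewise constancy and reduces dispersion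
to counting the instances with a critical point in a window of length 2ε.

Mean: the logarithm of a κ-smooth variable in [0, 1] is κ-smooth. Conditionally on one value of a
pair, the critical point thus lies in a window with probability at most κ ln C times its length.
Summing over T n²/2 pairs and using κ ≥ 1 gives T ε n² κ² ln C (`crossingMass_Icc_le`).

Uniformity in ρ: let M be the expected number of critical points as a measure. Cutting the line at
the integer levels of its distribution function yields (T n² + 1)² cells, and every window lies in a
cell whose mass exceeds its own by at most 2 (`exists_Icc_subset_cell`). For a fixed cell, the
indicators that an instance hits it are independent in t, so the centred count is sub-Gaussian with
parameter T/4. A sum of exponentials over the cells controls all of them at once. This sum is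
measurable, so it bounds the upper expectation whatever the tie-breaking rule.

The ½-dispersion follows because ε ≥ T^(-1/2) means √T ≤ ε T. -/

namespace Knapsack

/-! ### The greedy algorithm on lists of items -/

section Greedy

variable {n : ℕ}

/-- The total value that the greedy algorithm collects from a list of items with remaining
capacity `r`. -/
noncomputable def greedyValue (v s : Fin n → ℝ) : ℝ → List (Fin n) → ℝ
  | _, [] => 0
  | r, i :: l => if s i ≤ r then v i + greedyValue v s (r - s i) l else greedyValue v s r l

theorem greedyValue_eq_zero {v s : Fin n → ℝ} {l : List (Fin n)} (h : ∀ i ∈ l, v i = 0) (r : ℝ) :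
    greedyValue v s r l = 0 := by
  induction l generalizing r with
  | nil => rfl
  | cons i l ih =>
    have hl : ∀ j ∈ l, v j = 0 := fun j hj => h j (List.mem_cons_of_mem i hj)
    simp [greedyValue, ih hl, h i List.mem_cons_self]

/-- This trades the accumulated set for a recursion on the list, which suits induction when two
orders are compared. Distinctness of the items is what lets each insertion add its value once. -/
theorem sum_foldl_greedyStep (v s : Fin n → ℝ) {l : List (Fin n)} (hl : l.Nodup)
    (S : Finset (Fin n)) (hS : ∀ i ∈ l, i ∉ S) (r : ℝ) :
    ∑ i ∈ (l.foldl (greedyStep s) (S, r)).1, v i = ∑ i ∈ S, v i + greedyValue v s r l := by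
  induction l generalizing S r with
  | nil => simp [greedyValue]
  | cons i l ih =>
    rw [List.nodup_cons] at hl
    have hi : i ∉ S := hS i List.mem_cons_self
    rw [List.foldl_cons]
    by_cases h : s i ≤ r
    · have e : greedyStep s (S, r) i = (insert i S, r - s i) := by simp [greedyStep, h]
      rw [e, ih hl.2, Finset.sum_insert hi, greedyValue, if_pos h]
      · ring
      · intro j hj hj'
        rcases Finset.mem_insert.1 hj' with rfl | hj'
        · exact hl.1 hj
        · exact hS j (List.mem_cons_of_mem i hj) hj'
    · have e : greedyStep s (S, r) i = (S, r) := by simp [greedyStep, h]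
      rw [e, ih hl.2 S (fun j hj => hS j (List.mem_cons_of_mem i hj)), greedyValue, if_neg h]

theorem greedyLoss_eq (v s : Fin n → ℝ) (C : ℝ) (π : Equiv.Perm (Fin n)) :
    greedyLoss v s C π = C - greedyValue v s C ((List.finRange n).map π) := by
  have h := sum_foldl_greedyStep v s (l := (List.finRange n).map π)
    ((List.nodup_finRange n).map π.injective) ∅ (by simp) C
  rw [List.foldl_map, Finset.sum_empty, zero_add] at h
  rw [greedyLoss, greedySet, h]

/-- As long as the sizes agree, both runs stay in the same state. At the first position where they
may differ the value is zero, hence so are all later values, and the capacities no longer matter. -/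
theorem greedyValue_map_congr {v s : Fin n → ℝ} {π π' : Fin n → Fin n} {l : List (Fin n)}
    (hv : ∀ k, v (π k) = v (π' k)) (hs : ∀ k, s (π k) = s (π' k) ∨ v (π k) = 0)
    (hl : l.Pairwise fun j k => v (π j) = 0 → v (π k) = 0) (r : ℝ) :
    greedyValue v s r (l.map π) = greedyValue v s r (l.map π') := by
  induction l generalizing r with
  | nil => rfl
  | cons k l ih =>
    rw [List.pairwise_cons] at hl
    rcases hs k with h | h
    · simp only [List.map_cons, greedyValue, h, hv k, ih hl.2]
    · rw [greedyValue_eq_zero, greedyValue_eq_zero]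
      · intro i hi
        rw [List.mem_map] at hi
        obtain ⟨j, hj, rfl⟩ := hi
        rw [← hv]
        rcases List.mem_cons.1 hj with rfl | hj
        exacts [h, hl.1 j hj h]
      · intro i hi
        rw [List.mem_map] at hi
        obtain ⟨j, hj, rfl⟩ := hi
        rcases List.mem_cons.1 hj with rfl | hj
        exacts [h, hl.1 j hj h]

/-- The loss does not depend on how ties are broken, provided that tied items have the same value
and, unless the value is zero, the same size. -/
theorem greedyLoss_eq_of_antitone {v s w : Fin n → ℝ} (C : ℝ) {π π' : Equiv.Perm (Fin n)}
    (hw : ∀ i, 0 ≤ w i) (hw0 : ∀ i, w i = 0 ↔ v i = 0)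
    (hvs : ∀ i j, w i = w j → v i = v j ∧ (s i = s j ∨ v i = 0))
    (hπ : Antitone fun k => w (π k)) (hπ' : Antitone fun k => w (π' k)) :
    greedyLoss v s C π = greedyLoss v s C π' := by
  -- Sorting determines the sequence of scores, so the two orders place tied items at each position.
  have h : ∀ k, w (π k) = w (π' k) := congrFun (Tuple.unique_antitone (f := w) hπ hπ')
  rw [greedyLoss_eq, greedyLoss_eq]
  congr 1
  refine greedyValue_map_congr (fun k => (hvs _ _ (h k)).1) (fun k => (hvs _ _ (h k)).2) ?_ C
  refine (List.pairwise_lt_finRange n).imp fun {j k} hjk hj => ?_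
  rw [← hw0] at hj ⊢
  exact le_antisymm (hj ▸ hπ hjk.le) (hw _)

/-! ### Critical parameters -/

/-- The pairs of items whose scores can cross, each pair listed once. -/
noncomputable def crossingPairs (s : Fin n → ℝ) : Finset (Fin n × Fin n) :=
  Finset.univ.filter fun p => s p.2 < s p.1

/-- The parameter at which the scores of two items of different sizes agree. -/
noncomputable def crossing (v s : Fin n → ℝ) (p : Fin n × Fin n) : ℝ :=
  (Real.log (v p.1) - Real.log (v p.2)) / (Real.log (s p.1) - Real.log (s p.2))

/-- The strict inequality makes the set disjoint from its mirror image. The factor 2 gained here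
later cancels the length 2ε of the window. -/
theorem two_mul_card_crossingPairs_le (s : Fin n → ℝ) : 2 * (crossingPairs s).card ≤ n ^ 2 := by
  have hd : Disjoint (crossingPairs s) ((crossingPairs s).map (Equiv.prodComm _ _).toEmbedding) := by
    rw [Finset.disjoint_left]
    rintro ⟨i, j⟩ h h'
    simp only [crossingPairs, Finset.mem_map, Finset.mem_filter, Finset.mem_univ, true_and,
      Equiv.coe_toEmbedding, Prod.exists] at h h'
    obtain ⟨a, b, hab, e⟩ := h'
    simp only [Equiv.prodComm_apply, Prod.swap_prod_mk, Prod.mk.injEq] at e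
    obtain ⟨rfl, rfl⟩ := e
    exact lt_asymm h hab
  have h := Finset.card_le_univ
    ((crossingPairs s).disjUnion ((crossingPairs s).map (Equiv.prodComm _ _).toEmbedding) hd)
  rw [Finset.card_disjUnion, Finset.card_map, Fintype.card_prod, Fintype.card_fin] at h
  rw [two_mul, sq]
  exact h

theorem score_pos {v s : Fin n → ℝ} {i : Fin n} (hs : 0 < s i) (hv : 0 < v i) (ρ : ℝ) :
    0 < score v s ρ i := div_pos hv (Real.rpow_pos_of_pos hs ρ)

theorem score_eq_zero_iff {v s : Fin n → ℝ} {i : Fin n} (hs : 0 < s i) (ρ : ℝ) :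
    score v s ρ i = 0 ↔ v i = 0 := by
  simp [score, (Real.rpow_pos_of_pos hs ρ).ne']

theorem log_score {v s : Fin n → ℝ} {i : Fin n} (hs : 0 < s i) (hv : 0 < v i) (ρ : ℝ) :
    Real.log (score v s ρ i) = Real.log (v i) - ρ * Real.log (s i) := by
  rw [score, Real.log_div hv.ne' (Real.rpow_pos_of_pos hs ρ).ne', Real.log_rpow hs]

theorem score_le_score_iff {v s : Fin n → ℝ} {i j : Fin n} (hsi : 0 < s i) (hsj : 0 < s j)
    (hvi : 0 < v i) (hvj : 0 < v j) (ρ : ℝ) :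
    score v s ρ i ≤ score v s ρ j ↔
      Real.log (v i) - Real.log (v j) ≤ ρ * (Real.log (s i) - Real.log (s j)) := by
  rw [← Real.log_le_log_iff (score_pos hsi hvi ρ) (score_pos hsj hvj ρ), log_score hsi hvi,
    log_score hsj hvj]
  constructor <;> intro h <;> linarith

theorem score_le_score_iff_of_size_lt {v s : Fin n → ℝ} {i j : Fin n} (hsj : 0 < s j)
    (hij : s j < s i) (hvi : 0 < v i) (hvj : 0 < v j) (ρ : ℝ) :
    score v s ρ i ≤ score v s ρ j ↔ crossing v s (i, j) ≤ ρ := by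
  rw [score_le_score_iff (hsj.trans hij) hsj hvi hvj, crossing,
    div_le_iff₀ (sub_pos.2 (Real.log_lt_log hsj hij))]

theorem score_le_score_iff_of_size_gt {v s : Fin n → ℝ} {i j : Fin n} (hsi : 0 < s i)
    (hij : s i < s j) (hvi : 0 < v i) (hvj : 0 < v j) (ρ : ℝ) :
    score v s ρ i ≤ score v s ρ j ↔ ρ ≤ crossing v s (j, i) := by
  rw [score_le_score_iff hsi (hsi.trans hij) hvi hvj, crossing,
    le_div_iff₀ (sub_pos.2 (Real.log_lt_log hsi hij))]
  constructor <;> intro h <;> linarith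

/-- The order of the scores changes only at critical parameters. -/
theorem score_le_score_congr {v s : Fin n → ℝ} (hs : ∀ i, 0 < s i) (hv : ∀ i, 0 ≤ v i) {x y : ℝ}
    (hxy : x ≤ y) (h : ∀ p ∈ crossingPairs s, crossing v s p ∉ Set.Icc x y) (i j : Fin n) :
    score v s x i ≤ score v s x j ↔ score v s y i ≤ score v s y j := by
  have hnn : ∀ ρ i, 0 ≤ score v s ρ i := fun ρ i =>
    div_nonneg (hv i) (Real.rpow_nonneg (hs i).le ρ)
  -- A zero value gives score zero at every parameter. It is treated apart because `Real.log 0 = 0`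
  -- makes `crossing` meaningless there; such spurious critical points only strengthen the
  -- hypothesis `h`.
  rcases (hv i).eq_or_lt' with hi | hi
  · rw [(score_eq_zero_iff (hs i) x).2 hi, (score_eq_zero_iff (hs i) y).2 hi]
    simp only [hnn]
  rcases (hv j).eq_or_lt' with hj | hj
  · rw [(score_eq_zero_iff (hs j) x).2 hj, (score_eq_zero_iff (hs j) y).2 hj]
    simp only [(score_pos (hs i) hi _).not_ge]
  rcases lt_trichotomy (s i) (s j) with hij | hij | hij
  · rw [score_le_score_iff_of_size_gt (hs i) hij hi hj, score_le_score_iff_of_size_gt (hs i) hij hi hj]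
    have := h (j, i) (by simp [crossingPairs, hij])
    rw [Set.mem_Icc, not_and, not_le] at this
    exact ⟨fun hx => (this hx).le, hxy.trans⟩
  · rw [score_le_score_iff (hs i) (hs j) hi hj, score_le_score_iff (hs i) (hs j) hi hj, hij]
    simp
  · rw [score_le_score_iff_of_size_lt (hs j) hij hi hj, score_le_score_iff_of_size_lt (hs j) hij hi hj]
    have := h (i, j) (by simp [crossingPairs, hij])
    rw [Set.mem_Icc, not_and', not_le] at this
    exact ⟨fun hx => hx.trans hxy, fun hy => (this hy).le⟩

/-- At a noncritical parameter, different sizes with positive values cannot tie. This is the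
condition on ties required by `greedyLoss_eq_of_antitone`. -/
theorem eq_of_score_eq {v s : Fin n → ℝ} (hs : ∀ i, 0 < s i) (hv : ∀ i, 0 ≤ v i) {x : ℝ}
    (h : ∀ p ∈ crossingPairs s, crossing v s p ≠ x) {i j : Fin n}
    (hij : score v s x i = score v s x j) : v i = v j ∧ (s i = s j ∨ v i = 0) := by
  rcases (hv i).eq_or_lt' with hi | hi
  · rw [(score_eq_zero_iff (hs i) x).2 hi, eq_comm, score_eq_zero_iff (hs j)] at hij
    exact ⟨hi.trans hij.symm, Or.inr hi⟩
  rcases (hv j).eq_or_lt' with hj | hj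
  · rw [(score_eq_zero_iff (hs j) x).2 hj, score_eq_zero_iff (hs i)] at hij
    exact absurd hij hi.ne'
  rcases lt_trichotomy (s i) (s j) with h' | h' | h'
  · refine absurd ?_ (h (j, i) (by simp [crossingPairs, h']))
    exact le_antisymm ((score_le_score_iff_of_size_lt (hs i) h' hj hi x).1 hij.ge)
      ((score_le_score_iff_of_size_gt (hs i) h' hi hj x).1 hij.le)
  · refine ⟨?_, Or.inl h'⟩
    rw [score, score, h'] at hij
    exact (div_left_inj' (Real.rpow_pos_of_pos (hs j) x).ne').1 hij
  · refine absurd ?_ (h (i, j) (by simp [crossingPairs, h']))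
    exact le_antisymm ((score_le_score_iff_of_size_lt (hs j) h' hi hj x).1 hij.le)
      ((score_le_score_iff_of_size_gt (hs j) h' hj hi x).1 hij.ge)

/-- The loss is constant on every interval without critical parameters. -/
theorem greedyLoss_eq_of_crossing_notMem {v s : Fin n → ℝ} (hs : ∀ i, 0 < s i)
    (hv : ∀ i, 0 ≤ v i) (C : ℝ) {x y : ℝ} (hxy : x ≤ y)
    (h : ∀ p ∈ crossingPairs s, crossing v s p ∉ Set.Icc x y) {π π' : Equiv.Perm (Fin n)}
    (hπ : IsScoreOrder v s x π) (hπ' : IsScoreOrder v s y π') :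
    greedyLoss v s C π = greedyLoss v s C π' := by
  -- Both orders are compared through the scores at `x`: the order used at `y` also sorts these,
  -- since no scores cross in between.
  refine greedyLoss_eq_of_antitone (w := score v s x) C
    (fun i => div_nonneg (hv i) (Real.rpow_nonneg (hs i).le x))
    (fun i => score_eq_zero_iff (hs i) x) (fun i j hij => eq_of_score_eq hs hv ?_ hij) hπ ?_
  · rintro p hp rfl
    exact h p hp ⟨le_rfl, hxy⟩
  · exact fun j k hjk => (score_le_score_congr hs hv hxy h _ _).2 (hπ' hjk)

end Greedy

/-! ### Functions that are constant away from finitely many points -/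

theorem piecewiseConstantOn_of_finset {f : ℝ → ℝ} {K : Set ℝ} (hK : K.OrdConnected)
    (F : Finset ℝ)
    (h : ∀ x ∈ K, ∀ y ∈ K, x ≤ y → (∀ c ∈ F, c ∉ Set.Icc x y) → f x = f y) :
    PiecewiseConstantOn f K := by
  classical
  -- The fibres of this monotone map are the single points of `F` and the gaps between them. Both
  -- `≤` and `<` are needed to separate a point of `F` from the gaps on its two sides.
  let g : ℝ → Finset ℝ × Finset ℝ := fun x => (F.filter (· ≤ x), F.filter (· < x))
  have hg : Monotone g := fun x y hxy =>
    ⟨Finset.monotone_filter_right F fun c _ hc => le_trans hc hxy,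
      Finset.monotone_filter_right F fun c _ hc => lt_of_lt_of_le hc hxy⟩
  have hmem : ∀ x, g x ∈ F.powerset ×ˢ F.powerset := fun x => by simp [g]
  have hconst : ∀ x ∈ K, ∀ y ∈ K, x ≤ y → g x = g y → f x = f y := by
    intro x hx y hy hxy e
    rcases hxy.eq_or_lt with rfl | hlt
    · rfl
    refine h x hx y hy hxy fun c hc hcI => ?_
    have e1 : c ∈ (g x).1 := by rw [e]; simp [g, hc, hcI.2]
    have hcx : c = x := le_antisymm (Finset.mem_filter.1 e1).2 hcI.1
    have e2 : c ∈ (g x).2 := by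
      rw [e]
      exact Finset.mem_filter.2 ⟨hc, hcx.trans_lt hlt⟩
    exact (Finset.mem_filter.1 e2).2.ne hcx
  refine ⟨(F.powerset ×ˢ F.powerset).image fun q => g ⁻¹' {q} ∩ K, ?_, ?_, ?_, ?_⟩
  · intro I hI
    obtain ⟨q, -, rfl⟩ := Finset.mem_image.1 hI
    exact (Set.ordConnected_singleton.preimage_mono hg).inter hK
  · intro I hI J hJ hIJ
    obtain ⟨q, -, rfl⟩ := Finset.mem_image.1 (Finset.mem_coe.1 hI)
    obtain ⟨q', -, rfl⟩ := Finset.mem_image.1 (Finset.mem_coe.1 hJ)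
    refine Set.disjoint_left.2 fun x hx hx' => hIJ ?_
    have e : q = q' := hx.1.symm.trans hx'.1
    rw [e]
  · ext x
    simp only [Set.mem_iUnion, Finset.mem_image, exists_prop]
    constructor
    · rintro ⟨_, ⟨q, -, rfl⟩, hx⟩
      exact hx.2
    · exact fun hx => ⟨_, ⟨g x, hmem x, rfl⟩, rfl, hx⟩
  · intro I hI
    obtain ⟨q, -, rfl⟩ := Finset.mem_image.1 hI
    rcases (g ⁻¹' {q} ∩ K).eq_empty_or_nonempty with he | ⟨x, hx⟩
    · exact ⟨0, fun ρ hρ => absurd hρ (by simp [he])⟩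
    · refine ⟨f x, fun ρ hρ => ?_⟩
      have e : g ρ = g x := hρ.1.trans hx.1.symm
      rcases le_total ρ x with hle | hle
      · exact hconst ρ hρ.2 x hx.2 hle e
      · exact (hconst x hx.2 ρ hρ.2 hle e.symm).symm

/-! ### The distribution of a critical parameter -/

section Smooth

variable {Ω : Type*} [MeasurableSpace Ω] {μ : Measure Ω} {κ : ℝ≥0} {X Y : Ω → ℝ}

theorem IsSmooth.map_le (h : IsSmooth μ κ X) : μ.map X ≤ κ • (volume : Measure ℝ) := by
  have := h.1
  rw [map_eq_withDensity_pdf X μ volume]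
  refine (withDensity_mono h.2).trans ?_
  rw [withDensity_const]
  rfl

theorem IsSmooth.map_apply_le (h : IsSmooth μ κ X) (A : Set ℝ) : μ.map X A ≤ κ * volume A :=
  h.map_le A

/-- Needed to pass from the factor κ, which the argument yields, to the κ² of the stated bound. -/
theorem IsSmooth.one_le [IsProbabilityMeasure μ] (h : IsSmooth μ κ X) (hX : Measurable X)
    (hX01 : ∀ ω, X ω ∈ Set.Icc (0 : ℝ) 1) : 1 ≤ κ := by
  have h1 := h.map_apply_le (Set.Icc 0 1)
  rw [Measure.map_apply hX measurableSet_Icc, show X ⁻¹' Set.Icc 0 1 = Set.univ from Set.eq_univ_of_forall hX01,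
    measure_univ] at h1
  simpa using h1

/-- The exponential is 1-Lipschitz on the nonpositive half-line, where logarithms of numbers in (0,
1] live. -/
theorem exp_min_zero_sub_exp_le {a b : ℝ} (h : a ≤ min b 0) :
    Real.exp (min b 0) - Real.exp a ≤ b - a := by
  have h1 : Real.exp (min b 0) ≤ 1 := Real.exp_le_one_iff.2 (min_le_right b 0)
  have h2 := Real.add_one_le_exp (a - min b 0)
  have h3 : Real.exp a = Real.exp (min b 0) * Real.exp (a - min b 0) := by
    rw [← Real.exp_add]
    congr 1
    ring
  have h4 := min_le_left b 0
  rw [h3]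
  nlinarith [Real.exp_pos (min b 0)]

/-- The logarithm of a `κ`-smooth variable in `[0, 1]` is again `κ`-smooth. -/
theorem IsSmooth.map_log_mem_Icc_le (h : IsSmooth μ κ X) (hX : Measurable X)
    (hX01 : ∀ ω, X ω ∈ Set.Icc (0 : ℝ) 1) (a b : ℝ) :
    μ.map X {x | Real.log x ∈ Set.Icc a b} ≤ κ * ENNReal.ofReal (b - a) := by
  have hm : MeasurableSet {x | Real.log x ∈ Set.Icc a b} :=
    Real.measurable_log measurableSet_Icc
  -- The point 0 is added because `Real.log 0 = 0` may lie in the window; it is a null set.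
  have hle : μ.map X {x | Real.log x ∈ Set.Icc a b} ≤
      μ.map X ({0} ∪ Set.Icc (Real.exp a) (Real.exp (min b 0))) := by
    rw [Measure.map_apply hX hm,
      Measure.map_apply hX ((measurableSet_singleton 0).union measurableSet_Icc)]
    refine measure_mono fun ω hω => ?_
    rcases (hX01 ω).1.eq_or_lt' with h0 | h0
    · exact Or.inl h0
    · refine Or.inr ⟨(Real.le_log_iff_exp_le h0).1 hω.1, (Real.log_le_iff_le_exp h0).1 ?_⟩
      exact le_min hω.2 (Real.log_nonpos h0.le (hX01 ω).2)
  refine hle.trans ((h.map_apply_le _).trans ?_)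
  gcongr
  refine (measure_union_le _ _).trans ?_
  rw [Real.volume_singleton, zero_add, Real.volume_Icc]
  rcases le_total a (min b 0) with hab | hab
  · exact ENNReal.ofReal_le_ofReal (exp_min_zero_sub_exp_le hab)
  · rw [ENNReal.ofReal_of_nonpos (sub_nonpos.2 (Real.exp_le_exp.2 hab))]
    exact zero_le

/-- By independence and Fubini, `Y` may be frozen; `Real.log X` then has to lie in an interval of
length D(b − a). -/
theorem IsSmooth.measure_log_sub_log_div_mem_le [IsProbabilityMeasure μ] (h : IsSmooth μ κ X)
    (hX : Measurable X) (hY : Measurable Y) (hX01 : ∀ ω, X ω ∈ Set.Icc (0 : ℝ) 1)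
    (hXY : IndepFun X Y μ) {D : ℝ} (hD : 0 < D) (a b : ℝ) :
    μ {ω | (Real.log (X ω) - Real.log (Y ω)) / D ∈ Set.Icc a b} ≤
      κ * ENNReal.ofReal (D * (b - a)) := by
  have : IsProbabilityMeasure (μ.map X) := Measure.isProbabilityMeasure_map hX.aemeasurable
  have : IsProbabilityMeasure (μ.map Y) := Measure.isProbabilityMeasure_map hY.aemeasurable
  let S : Set (ℝ × ℝ) := {q | (Real.log q.1 - Real.log q.2) / D ∈ Set.Icc a b}
  have hS : MeasurableSet S := by
    refine (Measurable.div_const ?_ D) measurableSet_Icc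
    exact (Real.measurable_log.comp measurable_fst).sub (Real.measurable_log.comp measurable_snd)
  calc μ {ω | (Real.log (X ω) - Real.log (Y ω)) / D ∈ Set.Icc a b}
      = μ.map (fun ω => (X ω, Y ω)) S := (Measure.map_apply (hX.prodMk hY) hS).symm
    _ = ∫⁻ y, μ.map X ((fun x => (x, y)) ⁻¹' S) ∂(μ.map Y) := by
        rw [(indepFun_iff_map_prod_eq_prod_map_map hX.aemeasurable hY.aemeasurable).1 hXY,
          Measure.prod_apply_symm hS]
    _ ≤ ∫⁻ _, κ * ENNReal.ofReal (D * (b - a)) ∂(μ.map Y) := by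
        refine lintegral_mono fun y => ?_
        have e : (fun x => (x, y)) ⁻¹' S =
            {x | Real.log x ∈ Set.Icc (Real.log y + a * D) (Real.log y + b * D)} := by
          ext x
          simp only [S, Set.mem_preimage, Set.mem_ofPred_eq, Set.mem_Icc, le_div_iff₀ hD,
            div_le_iff₀ hD]
          constructor <;> rintro ⟨h1, h2⟩ <;> constructor <;> linarith
        rw [e]
        refine (h.map_log_mem_Icc_le hX hX01 _ _).trans (le_of_eq ?_)
        congr 2
        ring
    _ = κ * ENNReal.ofReal (D * (b - a)) := by simp

end Smooth

/-! ### Cells of equal mass -/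

section Cells

variable (M : Measure ℝ)

/-- The points at which the distribution function of `M` lies in `[k, l + 1)`. -/
def cell (k l : ℕ) : Set ℝ := (fun x => M.real (Set.Iic x)) ⁻¹' Set.Ico (k : ℝ) (l + 1)

variable [IsFiniteMeasure M]

theorem monotone_measureReal_Iic : Monotone fun x => M.real (Set.Iic x) :=
  fun _ _ h => measureReal_mono (Set.Iic_subset_Iic.2 h)

theorem measurableSet_cell (k l : ℕ) : MeasurableSet (cell M k l) :=
  (monotone_measureReal_Iic M).measurable measurableSet_Ico

theorem measureReal_Ioc_eq_sub {x y : ℝ} (h : x ≤ y) :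
    M.real (Set.Ioc x y) = M.real (Set.Iic y) - M.real (Set.Iic x) := by
  have e : Set.Ioc x y = Set.Iic y \ Set.Iic x := by
    ext z
    simp [and_comm]
  rw [e, measureReal_sdiff (Set.Iic_subset_Iic.2 h) measurableSet_Iic]

/-- A cell need not contain its endpoints, so its mass is approximated from inside by compact sets.
These contain their extrema, where the distribution function is controlled, and the absence of atoms
makes closed and half-open intervals equal in mass. -/
theorem measureReal_cell_le [NullSingletonClass M] {k l : ℕ} (h : k ≤ l) :
    M.real (cell M k l) ≤ l + 1 - k := by
  have h0 : (0 : ℝ) ≤ l + 1 - k := by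
    have : (k : ℝ) ≤ l := by exact_mod_cast h
    linarith
  refine ENNReal.toReal_le_of_le_ofReal h0 ?_
  rw [(measurableSet_cell M k l).measure_eq_iSup_isCompact]
  refine iSup_le fun K => iSup_le fun hK => iSup_le fun hKc => ?_
  rcases K.eq_empty_or_nonempty with rfl | hne
  · simp
  have hx := hK (hKc.sInf_mem hne)
  have hy := hK (hKc.sSup_mem hne)
  have hxy : sInf K ≤ sSup K := 
    Real.sInf_le_sSup K hKc.isBounded.bddBelow hKc.isBounded.bddAbove
  have hsub : K ⊆ Set.Icc (sInf K) (sSup K) := fun z hz =>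
    ⟨csInf_le hKc.isBounded.bddBelow hz, le_csSup hKc.isBounded.bddAbove hz⟩
  refine (measure_mono hsub).trans ?_
  rw [← Ioc_ae_eq_Icc.measure_eq, ← ofReal_measureReal, measureReal_Ioc_eq_sub M hxy]
  refine ENNReal.ofReal_le_ofReal ?_
  have h1 : (k : ℝ) ≤ M.real (Set.Iic (sInf K)) := hx.1
  have h2 : M.real (Set.Iic (sSup K)) < l + 1 := hy.2
  linarith

/-- Every interval is contained in a cell whose mass is not much larger. -/
theorem exists_Icc_subset_cell [NullSingletonClass M] {N : ℕ} (hN : M.real Set.univ ≤ N) {x y : ℝ}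
    (hxy : x ≤ y) : ∃ k < N + 1, ∃ l < N + 1, Set.Icc x y ⊆ cell M k l ∧
      M.real (cell M k l) ≤ M.real (Set.Icc x y) + 2 := by
  have hmono := monotone_measureReal_Iic M hxy
  have hfl : ∀ z, ⌊M.real (Set.Iic z)⌋₊ < N + 1 := fun z => by
    refine Nat.lt_succ_of_le (Nat.floor_le_of_le ?_)
    exact (measureReal_mono (Set.subset_univ _)).trans hN
  -- The levels are the integer parts of the distribution function at `x` and `y`; rounding costs at
  -- most 1 at each end.
  refine ⟨_, hfl x, _, hfl y, fun z hz => ⟨?_, ?_⟩, ?_⟩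
  · exact (Nat.floor_le measureReal_nonneg).trans (monotone_measureReal_Iic M hz.1)
  · exact (monotone_measureReal_Iic M hz.2).trans_lt (Nat.lt_floor_add_one _)
  · refine (measureReal_cell_le M (Nat.floor_le_floor hmono)).trans ?_
    have h1 := Nat.lt_floor_add_one (M.real (Set.Iic x))
    have h2 := Nat.floor_le (measureReal_nonneg (μ := M) (s := Set.Iic y))
    have h3 := measureReal_Ioc_eq_sub M hxy
    have h4 : M.real (Set.Icc x y) = M.real (Set.Ioc x y) := by
      rw [measureReal_def, measureReal_def, Ioc_ae_eq_Icc.measure_eq]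
    linarith

end Cells

/-! ### Concentration -/

section Concentration

variable {Ω : Type*} [MeasurableSpace Ω] {μ : Measure Ω}

theorem hasSubgaussianMGF_sum_range [IsProbabilityMeasure μ] {n : ℕ} {v : ℕ → Fin n → Ω → ℝ}
    (hv : ∀ t i, Measurable (v t i)) (hind : iIndepFun (fun p : ℕ × Fin n => v p.1 p.2) μ)
    {h : ℕ → (Fin n → ℝ) → ℝ} (hh : ∀ t, Measurable (h t))
    (h01 : ∀ t x, h t x ∈ Set.Icc (0 : ℝ) 1) (T : ℕ) :
    HasSubgaussianMGF (fun ω => ∑ t ∈ Finset.range T,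
      (h t (fun i => v t i ω) - ∫ ω', h t (fun i => v t i ω') ∂μ)) (T / 4) μ := by
  induction T with
  | zero => simp
  | succ T ih =>
    have hm : ∀ t, Measurable fun ω => h t (fun i => v t i ω) := fun t =>
      (hh t).comp (measurable_pi_iff.2 (hv t))
    have h1 := hasSubgaussianMGF_of_mem_Icc (μ := μ) (hm T).aemeasurable
      (Filter.Eventually.of_forall fun ω => h01 T fun i => v T i ω)
    have hc : ((‖(1 : ℝ) - 0‖₊ / 2) ^ 2 : ℝ≥0) = 1 / 4 := by
      rw [sub_zero, nnnorm_one]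
      norm_num
    rw [hc] at h1
    have hd : Disjoint (Finset.range T ×ˢ (Finset.univ : Finset (Fin n)))
        ({T} ×ˢ (Finset.univ : Finset (Fin n))) := by
      rw [Finset.disjoint_left]
      rintro ⟨t, i⟩ h2 h3
      simp only [Finset.mem_product, Finset.mem_range, Finset.mem_singleton] at h2 h3
      omega
    -- `φ` and `ψ` write the first T terms and the next one as functions of disjoint blocks of
    -- values, hence of independent vectors.
    let φ : (↥(Finset.range T ×ˢ (Finset.univ : Finset (Fin n))) → ℝ) → ℝ := fun x =>
      ∑ t ∈ (Finset.range T).attach,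
        (h t (fun i => x ⟨(t, i), Finset.mem_product.2 ⟨t.2, Finset.mem_univ i⟩⟩) -
          ∫ ω', h t (fun i => v t i ω') ∂μ)
    let ψ : (↥({T} ×ˢ (Finset.univ : Finset (Fin n))) → ℝ) → ℝ := fun x =>
      h T (fun i => x ⟨(T, i), by simp⟩) - ∫ ω', h T (fun i => v T i ω') ∂μ
    have hφ : Measurable φ := Finset.measurable_fun_sum _ fun t _ =>
      ((hh t).comp (measurable_pi_iff.2 fun i => measurable_pi_apply
        (⟨(t, i), Finset.mem_product.2 ⟨t.2, Finset.mem_univ i⟩⟩ :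
          ↥(Finset.range T ×ˢ (Finset.univ : Finset (Fin n)))))).sub_const _
    have hψ : Measurable ψ :=
      ((hh T).comp (measurable_pi_iff.2 fun i => measurable_pi_apply
        (⟨(T, i), by simp⟩ : ↥({T} ×ˢ (Finset.univ : Finset (Fin n)))))).sub_const _
    have hI := (hind.indepFun_finset _ _ hd (fun p => hv p.1 p.2)).comp hφ hψ
    have h2 := ih.add_of_indepFun h1 (by
      refine hI.congr (Filter.Eventually.of_forall fun ω => ?_) (Filter.Eventually.of_forall fun ω => rfl)
      exact Finset.sum_attach (Finset.range T) fun t =>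
        h t (fun i => v t i ω) - ∫ ω', h t (fun i => v t i ω') ∂μ)
    have hc' : ((T + 1 : ℕ) / 4 : ℝ≥0) = T / 4 + 1 / 4 := by
      push_cast
      ring
    simp only [Finset.sum_range_succ]
    rw [hc']
    exact h2

/-- Exponential moments of a finite family of sub-Gaussian variables. -/
theorem lintegral_sum_exp_le {ι : Type*} (S : Finset ι) {Z : ι → Ω → ℝ} {c : ℝ≥0}
    (hZ : ∀ j ∈ S, HasSubgaussianMGF (Z j) c μ) (r a : ℝ) :
    ∫⁻ ω, ENNReal.ofReal (∑ j ∈ S, Real.exp (r * (Z j ω - a))) ∂μ ≤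
      ENNReal.ofReal (S.card * Real.exp (c * r ^ 2 / 2 - r * a)) := by
  have he : ∀ j ω, Real.exp (r * (Z j ω - a)) = Real.exp (r * Z j ω) * Real.exp (-(r * a)) := by
    intro j ω
    rw [← Real.exp_add]
    congr 1
    ring
  have hint : ∀ j ∈ S, Integrable (fun ω => Real.exp (r * (Z j ω - a))) μ := by
    intro j hj
    simp only [he]
    exact ((hZ j hj).integrable_exp_mul r).mul_const _
  rw [← ofReal_integral_eq_lintegral_ofReal (integrable_finsetSum S hint)
    (Filter.Eventually.of_forall fun ω => Finset.sum_nonneg fun j _ => (Real.exp_pos _).le),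
    integral_finsetSum S hint]
  refine ENNReal.ofReal_le_ofReal ?_
  rw [← nsmul_eq_mul]
  refine Finset.sum_le_card_nsmul S _ _ fun j hj => ?_
  simp only [he]
  rw [integral_mul_const, sub_eq_add_neg, Real.exp_add]
  exact mul_le_mul_of_nonneg_right ((hZ j hj).mgf_le r) (Real.exp_pos _).le

end Concentration

/-! ### Instances with a critical parameter in a given set -/

section Hit

variable {n : ℕ}

open Classical in
/-- Indicates whether the instance with values `x` has a critical parameter in `J`. -/
noncomputable def hit (s : Fin n → ℝ) (J : Set ℝ) (x : Fin n → ℝ) : ℝ :=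
  if ∃ p ∈ crossingPairs s, crossing x s p ∈ J then 1 else 0

theorem hit_mem_Icc (s : Fin n → ℝ) (J : Set ℝ) (x : Fin n → ℝ) :
    hit s J x ∈ Set.Icc (0 : ℝ) 1 := by
  unfold hit
  split_ifs <;> simp

theorem measurable_crossing (s : Fin n → ℝ) (p : Fin n × Fin n) :
    Measurable fun x : Fin n → ℝ => crossing x s p := by
  unfold crossing
  fun_prop

theorem measurable_hit (s : Fin n → ℝ) {J : Set ℝ} (hJ : MeasurableSet J) :
    Measurable (hit s J) := by
  refine Measurable.ite ?_ measurable_const measurable_const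
  have e : {x : Fin n → ℝ | ∃ p ∈ crossingPairs s, crossing x s p ∈ J} =
      ⋃ p ∈ crossingPairs s, (fun x => crossing x s p) ⁻¹' J := by
    ext x
    simp
  rw [e]
  exact Finset.measurableSet_biUnion _ fun p _ => measurable_crossing s p hJ

/-- The union bound is applied only in expectation, so dependence between pairs sharing an item does
no harm. Concentration uses `hit` itself, which stays in [0, 1]. -/
theorem hit_le_sum (s : Fin n → ℝ) (J : Set ℝ) (x : Fin n → ℝ) :
    hit s J x ≤ ∑ p ∈ crossingPairs s, J.indicator 1 (crossing x s p) := by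
  have h0 : ∀ p ∈ crossingPairs s, (0 : ℝ) ≤ J.indicator 1 (crossing x s p) := fun p _ =>
    Set.indicator_nonneg (fun _ _ => zero_le_one) _
  unfold hit
  split_ifs with h
  · obtain ⟨p, hp, hpJ⟩ := h
    refine le_trans ?_ (Finset.single_le_sum h0 hp)
    simp [hpJ]
  · exact Finset.sum_nonneg h0

/-- Being 0-Lipschitz means being constant. Allowing any `J` that contains the window lets a cell,
one of finitely many, take its place. -/
theorem nonLipschitzCount_le_sum_hit {v s : ℕ → Fin n → ℝ} (hs : ∀ t i, 0 < s t i)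
    (hv : ∀ t i, 0 ≤ v t i) (C : ℝ) {K : Set ℝ} {π : ℕ → ℝ → Equiv.Perm (Fin n)}
    (hπ : ∀ t, ∀ ρ ∈ K, IsScoreOrder (v t) (s t) ρ (π t ρ)) (T : ℕ) (ε ρ : ℝ) {J : Set ℝ}
    (hJ : Set.Icc (ρ - ε) (ρ + ε) ⊆ J) :
    (nonLipschitzCount K 0 (fun t ρ => greedyLoss (v t) (s t) C (π t ρ)) T ε ρ : ℝ) ≤
      ∑ t ∈ Finset.range T, hit (s t) J (v t) := by
  classical
  have hsub : {t : ℕ | t < T ∧ ¬ LipschitzOnWith 0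
      (fun ρ => greedyLoss (v t) (s t) C (π t ρ)) (Metric.closedBall ρ ε ∩ K)} ⊆
      ((Finset.range T).filter fun t =>
        ∃ p ∈ crossingPairs (s t), crossing (v t) (s t) p ∈ J : Finset ℕ) := by
    rintro t ⟨htT, ht⟩
    rw [Finset.mem_coe, Finset.mem_filter, Finset.mem_range]
    refine ⟨htT, ?_⟩
    by_contra! hno
    have key : ∀ x ∈ Metric.closedBall ρ ε ∩ K, ∀ y ∈ Metric.closedBall ρ ε ∩ K, x ≤ y →
        greedyLoss (v t) (s t) C (π t x) = greedyLoss (v t) (s t) C (π t y) := by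
      intro x hx y hy hxy
      rw [Real.closedBall_eq_Icc] at hx hy
      refine greedyLoss_eq_of_crossing_notMem (hs t) (hv t) C hxy (fun p hp hpI => ?_)
        (hπ t x hx.2) (hπ t y hy.2)
      exact hno p hp (hJ ⟨hx.1.1.trans hpI.1, hpI.2.trans hy.1.2⟩)
    refine ht fun x hx y hy => ?_
    beta_reduce
    rcases le_total x y with h | h
    · rw [key x hx y hy h, edist_self]
      exact zero_le
    · rw [key y hy x hx h, edist_self]
      exact zero_le
  have h1 := Set.ncard_le_ncard hsub (Finset.finite_toSet _)
  rw [Set.ncard_coe_finset] at h1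
  have h2 : ∑ t ∈ Finset.range T, hit (s t) J (v t) =
      ((Finset.range T).filter fun t =>
        ∃ p ∈ crossingPairs (s t), crossing (v t) (s t) p ∈ J).card := by
    simp only [hit, Finset.sum_boole]
  rw [h2]
  exact_mod_cast h1

end Hit

/-! ### The expected number of critical parameters -/

section Mass

variable {n : ℕ} {Ω : Type*} [MeasurableSpace Ω]

/-- The expected number of critical parameters of the first `T` instances, as a measure. -/
noncomputable def crossingMass (μ : Measure Ω) (s : ℕ → Fin n → ℝ) (v : ℕ → Fin n → Ω → ℝ)
    (T : ℕ) : Measure ℝ :=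
  ∑ t ∈ Finset.range T, ∑ p ∈ crossingPairs (s t),
    μ.map fun ω => crossing (fun i => v t i ω) (s t) p

variable {μ : Measure Ω} {s : ℕ → Fin n → ℝ} {v : ℕ → Fin n → Ω → ℝ}

theorem measurable_crossing_comp (hv : ∀ t i, Measurable (v t i)) (t : ℕ) (p : Fin n × Fin n) :
    Measurable fun ω => crossing (fun i => v t i ω) (s t) p :=
  (measurable_crossing (s t) p).comp (measurable_pi_iff.2 (hv t))

theorem crossingMass_apply (T : ℕ) (J : Set ℝ) :
    crossingMass μ s v T J = ∑ t ∈ Finset.range T, ∑ p ∈ crossingPairs (s t),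
      μ.map (fun ω => crossing (fun i => v t i ω) (s t) p) J := by
  simp [crossingMass, Measure.finsetSum_apply]

theorem sum_card_crossingPairs_le (T : ℕ) :
    ∑ t ∈ Finset.range T, ((crossingPairs (s t)).card : ℝ) ≤ T * n ^ 2 / 2 := by
  have h : ∀ t ∈ Finset.range T, ((crossingPairs (s t)).card : ℝ) ≤ n ^ 2 / 2 := fun t _ => by
    have : (2 * (crossingPairs (s t)).card : ℝ) ≤ n ^ 2 := by
      exact_mod_cast two_mul_card_crossingPairs_le (s t)
    linarith
  refine (Finset.sum_le_card_nsmul _ _ _ h).trans (le_of_eq ?_)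
  rw [Finset.card_range, nsmul_eq_mul]
  ring

theorem crossingMass_le {b : ℝ} (hb : 0 ≤ b) {T : ℕ} {J : Set ℝ}
    (h : ∀ t, ∀ p ∈ crossingPairs (s t),
      μ.map (fun ω => crossing (fun i => v t i ω) (s t) p) J ≤ ENNReal.ofReal b) :
    crossingMass μ s v T J ≤ ENNReal.ofReal (T * n ^ 2 / 2 * b) := by
  calc crossingMass μ s v T J
      ≤ ∑ t ∈ Finset.range T, ((crossingPairs (s t)).card : ℝ≥0∞) * ENNReal.ofReal b := by
        rw [crossingMass_apply]
        refine Finset.sum_le_sum fun t _ => ?_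
        rw [← nsmul_eq_mul]
        exact Finset.sum_le_card_nsmul _ _ _ (h t)
    _ = ENNReal.ofReal ((∑ t ∈ Finset.range T, ((crossingPairs (s t)).card : ℝ)) * b) := by
        rw [← Finset.sum_mul, ENNReal.ofReal_mul (Finset.sum_nonneg fun _ _ => Nat.cast_nonneg _),
          ENNReal.ofReal_sum_of_nonneg fun _ _ => Nat.cast_nonneg _]
        simp
    _ ≤ _ := ENNReal.ofReal_le_ofReal
        (mul_le_mul_of_nonneg_right (sum_card_crossingPairs_le T) hb)

theorem crossingMass_univ_le [IsProbabilityMeasure μ] (hv : ∀ t i, Measurable (v t i)) (T : ℕ) :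
    crossingMass μ s v T Set.univ ≤ ENNReal.ofReal (T * n ^ 2 / 2) := by
  have h := crossingMass_le (μ := μ) (s := s) (v := v) (T := T) (J := Set.univ) zero_le_one
    fun t p _ => by
      rw [Measure.map_apply (measurable_crossing_comp hv t p) MeasurableSet.univ, Set.preimage_univ,
        measure_univ, ENNReal.ofReal_one]
  rwa [mul_one] at h

variable {κ : ℝ≥0} {C : ℝ}

theorem crossingMass_Icc_le [IsProbabilityMeasure μ] (hs : ∀ t i, s t i ∈ Set.Icc 1 C) (hv : ∀ t i, Measurable (v t i))
    (hv01 : ∀ t i ω, v t i ω ∈ Set.Icc (0 : ℝ) 1) (hsm : ∀ t i, IsSmooth μ κ (v t i))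
    (hind : iIndepFun (fun p : ℕ × Fin n => v p.1 p.2) μ) (hC : 1 ≤ C) (T : ℕ) {x y : ℝ}
    (hxy : x ≤ y) :
    crossingMass μ s v T (Set.Icc x y) ≤
      ENNReal.ofReal (T * n ^ 2 / 2 * ((κ : ℝ) ^ 2 * Real.log C * (y - x))) := by
  refine crossingMass_le (mul_nonneg (mul_nonneg (sq_nonneg _) (Real.log_nonneg hC))
    (sub_nonneg.2 hxy)) fun t p hp => ?_
  have hlt : s t p.2 < s t p.1 := (Finset.mem_filter.1 hp).2
  have h2 : 0 < s t p.2 := one_pos.trans_le (hs t p.2).1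
  have hD : 0 < Real.log (s t p.1) - Real.log (s t p.2) := sub_pos.2 (Real.log_lt_log h2 hlt)
  have hne : (t, p.1) ≠ (t, p.2) := fun e => hlt.ne' (congrArg (s t) (Prod.ext_iff.1 e).2)
  rw [Measure.map_apply (measurable_crossing_comp hv t p) measurableSet_Icc]
  refine ((hsm t p.1).measure_log_sub_log_div_mem_le (hv t p.1) (hv t p.2) (hv01 t p.1)
    (hind.indepFun hne) hD x y).trans ?_
  have hκ : (1 : ℝ) ≤ κ := (hsm t p.1).one_le (hv t p.1) (hv01 t p.1)
  rw [← ENNReal.ofReal_coe_nnreal, ← ENNReal.ofReal_mul κ.coe_nonneg]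
  refine ENNReal.ofReal_le_ofReal ?_
  have hDC : Real.log (s t p.1) - Real.log (s t p.2) ≤ Real.log C := by
    have h3 := Real.log_le_log (h2.trans hlt) (hs t p.1).2
    have h4 := Real.log_nonneg (hs t p.2).1
    linarith
  rw [← mul_assoc]
  refine mul_le_mul_of_nonneg_right ?_ (sub_nonneg.2 hxy)
  exact mul_le_mul (le_self_pow₀ hκ two_ne_zero) hDC hD.le (sq_nonneg _)

theorem sum_integral_hit_le [IsProbabilityMeasure μ] (hv : ∀ t i, Measurable (v t i)) (T : ℕ) {J : Set ℝ}
    (hJ : MeasurableSet J) :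
    ∑ t ∈ Finset.range T, ∫ ω, hit (s t) J (fun i => v t i ω) ∂μ ≤
      (crossingMass μ s v T).real J := by
  have hmap : ∀ t p, (μ.map fun ω => crossing (fun i => v t i ω) (s t) p) J =
      μ ((fun ω => crossing (fun i => v t i ω) (s t) p) ⁻¹' J) := fun t p =>
    Measure.map_apply (measurable_crossing_comp hv t p) hJ
  rw [measureReal_def, crossingMass_apply, ENNReal.toReal_sum fun t _ => ENNReal.sum_ne_top.2
    fun p _ => by rw [hmap]; exact measure_ne_top _ _]
  refine Finset.sum_le_sum fun t _ => ?_
  rw [ENNReal.toReal_sum fun p _ => by rw [hmap]; exact measure_ne_top _ _]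
  have hm : ∀ p, MeasurableSet ((fun ω => crossing (fun i => v t i ω) (s t) p) ⁻¹' J) := fun p =>
    measurable_crossing_comp hv t p hJ
  have hi : ∀ p ∈ crossingPairs (s t), Integrable
      (((fun ω => crossing (fun i => v t i ω) (s t) p) ⁻¹' J).indicator (1 : Ω → ℝ)) μ := fun p _ =>
    (integrable_const (1 : ℝ)).indicator (hm p)
  calc ∫ ω, hit (s t) J (fun i => v t i ω) ∂μ
      ≤ ∫ ω, ∑ p ∈ crossingPairs (s t),
          ((fun ω => crossing (fun i => v t i ω) (s t) p) ⁻¹' J).indicator (1 : Ω → ℝ) ω ∂μ := by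
        refine integral_mono ?_ (integrable_finsetSum _ hi) fun ω => hit_le_sum (s t) J _
        exact Integrable.of_mem_Icc 0 1 ((measurable_hit (s t) hJ).comp
          (measurable_pi_iff.2 (hv t))).aemeasurable
          (Filter.Eventually.of_forall fun ω => hit_mem_Icc _ _ _)
    _ = _ := by
        rw [integral_finsetSum _ hi]
        refine Finset.sum_congr rfl fun p _ => ?_
        rw [integral_indicator_one (hm p), hmap, measureReal_def]

end Mass

/-! ### Dispersion -/

section Dispersion

/-- With T n ≥ 2 the added 1 is absorbed, and T n² + 1 ≤ (T n)³. -/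
theorem card_range_product_le {n T : ℕ} (hn : 2 ≤ n) (hT : 1 ≤ T) :
    (((Finset.range (T * n ^ 2 + 1) ×ˢ Finset.range (T * n ^ 2 + 1)).card : ℕ) : ℝ) ≤
      Real.exp (6 * Real.log (T * n)) := by
  have hz : 2 ≤ T * n := by nlinarith
  have h1 : T * n ^ 2 + 1 ≤ (T * n) ^ 3 := by
    have h2 : T * n ^ 2 ≤ (T * n) ^ 2 := by
      rw [mul_pow]
      exact Nat.mul_le_mul_right _ (Nat.le_self_pow two_ne_zero T)
    calc T * n ^ 2 + 1 ≤ (T * n) ^ 2 * 2 := by nlinarith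
      _ ≤ (T * n) ^ 2 * (T * n) := Nat.mul_le_mul_left _ hz
      _ = (T * n) ^ 3 := by ring
  have hpos : (0 : ℝ) < T * n := by
    have : (2 : ℝ) ≤ T * n := by exact_mod_cast hz
    linarith
  have e : Real.exp (6 * Real.log (T * n)) = ((T * n : ℝ) ^ 3) * ((T * n : ℝ) ^ 3) := by
    rw [mul_comm, Real.exp_mul, Real.exp_log hpos]
    norm_cast
    ring
  rw [e, Finset.card_product, Finset.card_range]
  exact_mod_cast Nat.mul_le_mul h1 h1

theorem coe_upperExpectation_le {Ω : Type*} [MeasurableSpace Ω] {μ : Measure Ω} {X g : Ω → ℝ≥0∞}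
    (hg : Measurable g) (h : ∀ ω, X ω ≤ g ω) {b : ℝ} (hb : 0 ≤ b)
    (hgb : ∫⁻ ω, g ω ∂μ ≤ ENNReal.ofReal b) : (upperExpectation μ X : EReal) ≤ (b : EReal) := by
  have h1 : upperExpectation μ X ≤ ENNReal.ofReal b := by
    unfold upperExpectation
    exact iInf₂_le_of_le g hg (iInf_le_of_le h hgb)
  have h2 : ((ENNReal.ofReal b : ℝ≥0∞) : EReal) = (b : EReal) := by
    rw [EReal.coe_ennreal_ofReal, max_eq_left hb]
  rw [← h2]
  exact EReal.coe_ennreal_le_coe_ennreal_iff.2 h1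

theorem BetaDispersedWith.of_fDispersed {Ω E : Type*} [MeasurableSpace Ω] [PseudoMetricSpace E]
    {μ : Measure Ω} {K : Set E} {L : ℝ≥0} {ℓ : ℕ → Ω → E → ℝ} {a b : ℝ} {n : ℕ} (hb : 0 ≤ b)
    (h : FDispersed μ K L ℓ fun T ε => T * ε * a + b * √(T * Real.log (T * n))) :
    BetaDispersedWith μ K L ℓ (1 / 2) (|a| + b * (1 + Real.log n)) 1 := by
  intro T ε hT hε
  have hT1 : (1 : ℝ) ≤ T := by exact_mod_cast hT
  have hT0 : (0 : ℝ) < T := one_pos.trans_le hT1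
  have hε0 : 0 < ε := (Real.rpow_pos_of_pos hT0 _).trans_le hε
  refine (h T ε hε0).trans (EReal.coe_le_coe_iff.2 ?_)
  have hlT := Real.log_nonneg hT1
  have hln : 0 ≤ Real.log n := Real.log_natCast_nonneg n
  have hsq : √(T : ℝ) ≤ ε * T := by
    rw [Real.rpow_neg hT0.le, ← Real.sqrt_eq_rpow] at hε
    have hs := Real.sqrt_pos.2 hT0
    calc √(T : ℝ) = (√(T : ℝ))⁻¹ * T := by
          field_simp
          exact Real.sq_sqrt hT0.le
      _ ≤ ε * T := mul_le_mul_of_nonneg_right hε hT0.le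
  have hL : Real.log (T * n) ≤ (1 + Real.log T) * (1 + Real.log n) := by
    rcases n.eq_zero_or_pos with rfl | hn
    · simp only [Nat.cast_zero, mul_zero, Real.log_zero]
      linarith
    · rw [Real.log_mul hT0.ne' (by positivity)]
      nlinarith
  have hP : 1 ≤ (1 + Real.log T) * (1 + Real.log n) := by nlinarith
  have hsL : √(Real.log (T * n)) ≤ (1 + Real.log T) * (1 + Real.log n) := by
    refine Real.sqrt_le_iff.2 ⟨by linarith, hL.trans ?_⟩
    nlinarith
  have hεT : 0 < ε * T := mul_pos hε0 hT0
  beta_reduce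
  rw [Real.sqrt_mul hT0.le, pow_one]
  have h1 : √(T : ℝ) * √(Real.log (T * n)) ≤ ε * T * ((1 + Real.log T) * (1 + Real.log n)) :=
    mul_le_mul hsq hsL (Real.sqrt_nonneg _) hεT.le
  have h2 : T * ε * a ≤ |a| * (ε * T) * (1 + Real.log T) := by
    have h3 : a * (ε * T) ≤ |a| * (ε * T) := mul_le_mul_of_nonneg_right (le_abs_self a) hεT.le
    have h4 : 0 ≤ |a| * (ε * T) * Real.log T := by positivity
    linarith
  have h5 := mul_le_mul_of_nonneg_left h1 hb
  linarith

variable {n : ℕ} {Ω : Type*} [MeasurableSpace Ω] {μ : Measure Ω} [IsProbabilityMeasure μ]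
  {s : ℕ → Fin n → ℝ} {v : ℕ → Fin n → Ω → ℝ} {κ : ℝ≥0} {C : ℝ}

/-- The greedy losses are dispersed when there are at least two items. -/
theorem expectedWorstCount_greedyLoss_le (hn : 2 ≤ n) (hs : ∀ t i, s t i ∈ Set.Icc 1 C)
    (hv : ∀ t i, Measurable (v t i)) (hv01 : ∀ t i ω, v t i ω ∈ Set.Icc (0 : ℝ) 1)
    (hsm : ∀ t i, IsSmooth μ κ (v t i)) (hind : iIndepFun (fun p : ℕ × Fin n => v p.1 p.2) μ)
    {K : Set ℝ} {π : ℕ → Ω → ℝ → Equiv.Perm (Fin n)}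
    (hπ : ∀ t ω, ∀ ρ ∈ K, IsScoreOrder (fun i => v t i ω) (s t) ρ (π t ω ρ))
    {T : ℕ} (hT : 1 ≤ T) {ε : ℝ} (hε : 0 < ε) :
    (expectedWorstCount μ K 0
      (fun t ω ρ => greedyLoss (fun i => v t i ω) (s t) C (π t ω ρ)) T ε : EReal) ≤
      ((T * ε * ((n : ℝ) ^ 2 * (κ : ℝ) ^ 2 * Real.log C) + 13 * √(T * Real.log (T * n)) : ℝ) :
        EReal) := by
  have hC : 1 ≤ C := (hs 0 ⟨0, by omega⟩).1.trans (hs 0 ⟨0, by omega⟩).2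
  have hlogC := Real.log_nonneg hC
  have hs0 : ∀ t i, 0 < s t i := fun t i => one_pos.trans_le (hs t i).1
  have hT0 : (0 : ℝ) < T := by exact_mod_cast hT
  have hz : (2 : ℝ) ≤ T * n := by exact_mod_cast (by nlinarith : 2 ≤ T * n)
  set l : ℝ := Real.log (T * n) with hl
  have hl2 : 1 / 2 ≤ l :=
    le_trans (by linarith [Real.log_two_gt_d9]) (Real.log_le_log two_pos hz)
  set q : ℝ := √(T * l) with hq
  have hq2 : q * q = T * l := Real.mul_self_sqrt (by positivity)
  have hq0 : 0 < q := Real.sqrt_pos.2 (by positivity)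
  have hqhalf : 1 / 2 ≤ q := by
    have hT1 : (1 : ℝ) ≤ T := by exact_mod_cast hT
    nlinarith
  have hTq : T / q ≤ 2 * q := by
    rw [div_le_iff₀ hq0, mul_assoc, hq2]
    nlinarith
  set M := crossingMass μ s v T with hM
  have hMuniv : M Set.univ ≤ ENNReal.ofReal (T * n ^ 2 / 2) := crossingMass_univ_le hv T
  have : IsFiniteMeasure M := ⟨hMuniv.trans_lt ENNReal.ofReal_lt_top⟩
  have hMIcc : ∀ {x y : ℝ}, x ≤ y → M (Set.Icc x y) ≤
      ENNReal.ofReal (T * n ^ 2 / 2 * ((κ : ℝ) ^ 2 * Real.log C * (y - x))) :=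
    crossingMass_Icc_le hs hv hv01 hsm hind hC T
  have : NullSingletonClass M := ⟨fun x => by simpa using hMIcc (le_refl x)⟩
  have hN : M.real Set.univ ≤ (T * n ^ 2 : ℕ) := by
    refine (ENNReal.toReal_le_of_le_ofReal (by positivity) hMuniv).trans ?_
    push_cast
    have : (0 : ℝ) ≤ T * n ^ 2 := by positivity
    linarith
  set m : ℝ := T * ε * ((n : ℝ) ^ 2 * (κ : ℝ) ^ 2 * Real.log C) with hm
  have hm0 : 0 ≤ m := by positivity
  let S := Finset.range (T * n ^ 2 + 1) ×ˢ Finset.range (T * n ^ 2 + 1)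
  let Z : ℕ × ℕ → Ω → ℝ := fun j ω => ∑ t ∈ Finset.range T,
    (hit (s t) (cell M j.1 j.2) (fun i => v t i ω) -
      ∫ ω', hit (s t) (cell M j.1 j.2) (fun i => v t i ω') ∂μ)
  have hZm : ∀ j, Measurable (Z j) := fun j => Finset.measurable_fun_sum _ fun t _ =>
    ((measurable_hit (s t) (measurableSet_cell M j.1 j.2)).comp
      (measurable_pi_iff.2 (hv t))).sub_const _
  have hZ : ∀ j ∈ S, HasSubgaussianMGF (Z j) (T / 4) μ := fun j _ =>
    hasSubgaussianMGF_sum_range hv hind (fun t => measurable_hit (s t) (measurableSet_cell M j.1 j.2))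
      (fun t => hit_mem_Icc _ _) T
  -- With l = log(T n) and q² = T l, the slope q/T turns the sub-Gaussian bound into exp(l/8) per
  -- cell. The shift 7q contributes exp(−7l), which beats the at most exp(6l) cells.
  let W : Ω → ℝ := fun ω => ∑ j ∈ S, Real.exp (q / T * (Z j ω - 7 * q))
  have hWm : Measurable W := Finset.measurable_fun_sum _ fun j _ =>
    Real.measurable_exp.comp (((hZm j).sub_const _).const_mul _)
  have hW : ∫⁻ ω, ENNReal.ofReal (W ω) ∂μ ≤ ENNReal.ofReal 1 := by
    refine (lintegral_sum_exp_le S hZ (q / T) (7 * q)).trans (ENNReal.ofReal_le_ofReal ?_)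
    have e : ((T / 4 : ℝ≥0) : ℝ) * (q / T) ^ 2 / 2 - q / T * (7 * q) = l / 8 - 7 * l := by
      push_cast
      field_simp
      linear_combination (-440) * hq2
    rw [e]
    calc (S.card : ℝ) * Real.exp (l / 8 - 7 * l)
        ≤ Real.exp (6 * l) * Real.exp (l / 8 - 7 * l) :=
          mul_le_mul_of_nonneg_right (card_range_product_le hn hT) (Real.exp_pos _).le
      _ = Real.exp (-(7 / 8 * l)) := by
          rw [← Real.exp_add]
          congr 1
          ring
      _ ≤ 1 := Real.exp_le_one_iff.2 (by linarith)
  have hW0 : ∀ ω, 0 ≤ W ω := fun ω => Finset.sum_nonneg fun j _ => (Real.exp_pos _).le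
  refine coe_upperExpectation_le
    (g := fun ω => ENNReal.ofReal (m + 2 + 7 * q) + ENNReal.ofReal (T / q) * ENNReal.ofReal (W ω))
    (measurable_const.add (hWm.ennreal_ofReal.const_mul _)) ?_ (by positivity) ?_
  · intro ω
    refine iSup₂_le fun ρ _ => ?_
    obtain ⟨j, hj, k, hk, hsub, hmass⟩ :=
      exists_Icc_subset_cell M hN (by linarith : ρ - ε ≤ ρ + ε)
    have hcount := nonLipschitzCount_le_sum_hit (v := fun t i => v t i ω) hs0
      (fun t i => (hv01 t i ω).1) C (fun t => hπ t ω) T ε ρ hsub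
    have hmean := sum_integral_hit_le (μ := μ) (s := s) hv T (measurableSet_cell M j k)
    rw [← hM] at hmean
    -- The window length 2ε cancels the factor 1/2 from the number of pairs.
    have hIcc : M.real (Set.Icc (ρ - ε) (ρ + ε)) ≤ m := by
      refine ENNReal.toReal_le_of_le_ofReal hm0 ((hMIcc (by linarith)).trans (le_of_eq ?_))
      rw [hm]
      congr 1
      ring
    have hZjk : Z (j, k) ω = ∑ t ∈ Finset.range T, hit (s t) (cell M j k) (fun i => v t i ω) -
        ∑ t ∈ Finset.range T, ∫ ω', hit (s t) (cell M j k) (fun i => v t i ω') ∂μ :=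
      Finset.sum_sub_distrib _ _
    have hjk : (j, k) ∈ S := Finset.mem_product.2 ⟨Finset.mem_range.2 hj, Finset.mem_range.2 hk⟩
    -- Since x ≤ exp x, each single deviation is bounded by the whole sum `W`, so no tail
    -- integration is needed.
    have hexp : q / T * (Z (j, k) ω - 7 * q) ≤ W ω := by
      have h1 := Real.add_one_le_exp (q / T * (Z (j, k) ω - 7 * q))
      have h2 : Real.exp (q / T * (Z (j, k) ω - 7 * q)) ≤ W ω :=
        Finset.single_le_sum (f := fun j => Real.exp (q / T * (Z j ω - 7 * q)))
          (fun _ _ => (Real.exp_pos _).le) hjk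
      linarith
    have hZW : Z (j, k) ω - 7 * q ≤ T / q * W ω := by
      calc Z (j, k) ω - 7 * q = T / q * (q / T * (Z (j, k) ω - 7 * q)) := by field_simp
        _ ≤ T / q * W ω := mul_le_mul_of_nonneg_left hexp (by positivity)
    rw [← ENNReal.ofReal_mul (by positivity), ← ENNReal.ofReal_add (by positivity)
      (mul_nonneg (by positivity) (hW0 ω)), ← ENNReal.ofReal_natCast]
    exact ENNReal.ofReal_le_ofReal (by linarith)
  · rw [lintegral_add_left measurable_const, lintegral_const_mul _ hWm.ennreal_ofReal,
      lintegral_const, measure_univ, mul_one]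
    refine (add_le_add_right (mul_le_mul_right hW _) _).trans ?_
    rw [← ENNReal.ofReal_mul (by positivity), ← ENNReal.ofReal_add (by positivity) (by positivity)]
    -- The constant 13 is 7 + 2 + 4: the shift 7q, then T/q ≤ 2q, and the rounding cost 2 ≤ 4q.
    exact ENNReal.ofReal_le_ofReal (by linarith)

theorem fDispersed_greedyLoss (hs : ∀ t i, s t i ∈ Set.Icc 1 C)
    (hv : ∀ t i, Measurable (v t i)) (hv01 : ∀ t i ω, v t i ω ∈ Set.Icc (0 : ℝ) 1)
    (hsm : ∀ t i, IsSmooth μ κ (v t i)) (hind : iIndepFun (fun p : ℕ × Fin n => v p.1 p.2) μ)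
    {K : Set ℝ} {π : ℕ → Ω → ℝ → Equiv.Perm (Fin n)}
    (hπ : ∀ t ω, ∀ ρ ∈ K, IsScoreOrder (fun i => v t i ω) (s t) ρ (π t ω ρ)) :
    FDispersed μ K 0 (fun t ω ρ => greedyLoss (fun i => v t i ω) (s t) C (π t ω ρ))
      fun T ε => T * ε * ((n : ℝ) ^ 2 * (κ : ℝ) ^ 2 * Real.log C) +
        13 * √(T * Real.log (T * n)) := by
  intro T ε hε
  by_cases h : 2 ≤ n ∧ 1 ≤ T
  · exact expectedWorstCount_greedyLoss_le h.1 hs hv hv01 hsm hind hπ h.2 hε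
  -- For n ≤ 1 or T = 0 there is nothing to count and only the sign of the bound matters. When n = 0
  -- nothing forces C ≥ 1, but the factor n² vanishes.
  have hC : 0 ≤ (n : ℝ) ^ 2 * (κ : ℝ) ^ 2 * Real.log C := by
    rcases n.eq_zero_or_pos with rfl | hn
    · simp
    · have := Real.log_nonneg ((hs 0 ⟨0, hn⟩).1.trans (hs 0 ⟨0, hn⟩).2)
      positivity
  refine coe_upperExpectation_le (g := fun _ => 0) measurable_const (fun ω => ?_)
    (by positivity) (by simp)
  refine iSup₂_le fun ρ _ => ?_
  have hcount := nonLipschitzCount_le_sum_hit (v := fun t i => v t i ω)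
    (fun t i => one_pos.trans_le (hs t i).1) (fun t i => (hv01 t i ω).1) C (fun t => hπ t ω) T ε ρ
    subset_rfl
  have h0 : ∑ t ∈ Finset.range T,
      hit (s t) (Set.Icc (ρ - ε) (ρ + ε)) (fun i => v t i ω) = 0 := by
    refine Finset.sum_eq_zero fun t ht => if_neg ?_
    rintro ⟨p, hp, -⟩
    have hlt : s t p.2 < s t p.1 := (Finset.mem_filter.1 hp).2
    have hn : n ≤ 1 := by
      have := Finset.mem_range.1 ht
      omega
    have : Subsingleton (Fin n) := Fin.subsingleton_iff_le_one.2 hn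
    exact hlt.ne (congrArg (s t) (Subsingleton.elim _ _))
  rw [h0] at hcount
  have : nonLipschitzCount K 0
      (fun t ρ => greedyLoss (fun i => v t i ω) (s t) C (π t ω ρ)) T ε ρ = 0 := by
    exact_mod_cast le_antisymm hcount (Nat.cast_nonneg _)
  simp [this]

end Dispersion

end Knapsack

theorem mainTheorem4 :
    ∃ A : ℝ, ∀ (n : ℕ) (κ : ℝ≥0) (C : ℝ), ∃ (B : ℝ) (k : ℕ),
      ∀ (Ω : Type*) [MeasurableSpace Ω] (μ : Measure Ω) [IsProbabilityMeasure μ]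
        (R : ℝ) (_ : 0 ≤ R)
        (s : ℕ → Fin n → ℝ) (_ : ∀ t i, s t i ∈ Set.Icc 1 C)
        (v : ℕ → Fin n → Ω → ℝ) (_ : ∀ t i, Measurable (v t i))
        (_ : ∀ t i ω, v t i ω ∈ Set.Icc (0 : ℝ) 1)
        (_ : ∀ t i, Knapsack.IsSmooth μ κ (v t i))
        (_ : iIndepFun (fun p : ℕ × Fin n => v p.1 p.2) μ)
        (π : ℕ → Ω → ℝ → Equiv.Perm (Fin n))
        (_ : ∀ t ω, ∀ ρ ∈ Set.Icc 0 R,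
          Knapsack.IsScoreOrder (fun i => v t i ω) (s t) ρ (π t ω ρ))
        (ℓ : ℕ → Ω → ℝ → ℝ)
        (_ : ∀ t ω ρ, ℓ t ω ρ = Knapsack.greedyLoss (fun i => v t i ω) (s t) C (π t ω ρ)),
        (∀ t ω, Knapsack.PiecewiseConstantOn (ℓ t ω) (Set.Icc 0 R)) ∧
        Knapsack.FDispersed μ (Set.Icc 0 R) 0 ℓ
          (fun T ε => T * ε * (n : ℝ) ^ 2 * (κ : ℝ) ^ 2 * Real.log C
            + A * √(T * Real.log (T * n))) ∧
        Knapsack.BetaDispersedWith μ (Set.Icc 0 R) 0 ℓ (1 / 2) B k := by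
  refine ⟨13, fun n κ C => ⟨|(n : ℝ) ^ 2 * (κ : ℝ) ^ 2 * Real.log C| + 13 * (1 + Real.log n), 1,
    fun Ω _ μ _ R _ s hs v hv hv01 hsm hind π hπ ℓ hℓ => ?_⟩⟩
  obtain rfl : ℓ = fun t ω ρ => Knapsack.greedyLoss (fun i => v t i ω) (s t) C (π t ω ρ) := by
    funext t ω ρ
    exact hℓ t ω ρ
  have hf := Knapsack.fDispersed_greedyLoss hs hv hv01 hsm hind hπ
  refine ⟨fun t ω => ?_, ?_, Knapsack.BetaDispersedWith.of_fDispersed (by norm_num) hf⟩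
  · classical
    refine Knapsack.piecewiseConstantOn_of_finset Set.ordConnected_Icc
      ((Knapsack.crossingPairs (s t)).image (Knapsack.crossing (fun i => v t i ω) (s t)))
      fun x hx y hy hxy hF => ?_
    exact Knapsack.greedyLoss_eq_of_crossing_notMem (fun i => one_pos.trans_le (hs t i).1)
      (fun i => (hv01 t i ω).1) C hxy
      (fun p hp => hF _ (Finset.mem_image_of_mem _ hp)) (hπ t ω x hx) (hπ t ω y hy)
  · convert hf using 4
    ring
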